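/- **Setting.** A *random pentagonal chain* is built from pentagons $O_1,O_2,\dots$, where $O_k$ is a 5-cycle with vertices cyclically labelled $x_1,\dots,x_5$. $PG_1=O_1$, and $PG_{n+1}$ is obtained from $PG_n$ by adding the pentagon $O_{n+1}$ and one edge joining $x_1$ of $O_{n+1}$ to a vertex $u_n$ of $O_n$. The vertex $u_1$ is an arbitrary vertex of $O_1$. For $n\ge 2$ the vertex $u_n\in\{x_2,x_3,x_4,x_5\}$ is random; put $Z_n^1=1$ if $u_n\in\{x_2,x_5\}$ and $Z^1_n=0$ otherwise, and $Z_n^2=1$ if $u_n\in\{x_3,x_4\}$ and $Z^2_n=0$ otherwise (so $Z_n^1+Z_n^2=1$). Assume that the pairs $(Z_n^1,Z_n^2)$, $n\ge2$, are independent and that there is a constant $p_1$ with $0<p_1<1$ such that, for all $n\ge 2$, $\mathbb P(Z_n^1=1)=p_1$ and $\mathbb P(Z_n^2=1)=1-p_1$. Nothing is assumed on how $u_n$ is chosen within $\{x_2,x_5\}$ or within $\{x_3,x_4\}$. For a finite graph $G$ let $$Gut(G)=\tfrac12\sum_{u\in V_G}\sum_{v\in V_G}d(u)\,d(v)\,d(u,v),$$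 where $d(v)$ is the degree of $v$ and $d(u,v)$ the graph distance. Let $$\begin{aligned} \sigma_1^2&=288^2p_1+432^2(1-p_1)-\big(288p_1+432(1-p_1)\big)^2,\\ \tilde\sigma_1^2&=156^2p_1+300^2(1-p_1)-\big(156p_1+300(1-p_1)\big)^2,\\ r_1&=288\cdot156\,p_1+432\cdot300\,(1-p_1)-\big(288p_1+432(1-p_1)\big)\big(156p_1+300(1-p_1)\big). \end{aligned}$$ **Theorem 3.1.** For every $n\ge2$, with $U_n=288Z_n^1+432Z_n^2$ and $V_n=156Z_n^1+300Z_n^2$, one has $\mathrm{Var}(U_n)=\sigma_1^2$, $\mathrm{Var}(V_n)=\tilde\sigma_1^2$ and $\mathrm{Cov}(U_n,V_n)=r_1$. Moreover: (i) For every $n\ge1$, $Gut(PG_n)$ is square-integrable and $$\begin{aligned}\mathrm{Var}\big(Gut(PG_n)\big)=\tfrac1{30}\Big(&\sigma_1^2n^5-5r_1n^4+10\tilde\sigma_1^2n^3+(65r_1-30\sigma_1^2-45\tilde\sigma_1^2)n^2\\&+(59\sigma_1^2+65\tilde\sigma_1^2-120r_1)n+(60r_1-30\sigma_1^2-30\tilde\sigma_1^2)\Big).\end{aligned}$$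 (ii) $$\lim_{n\to\infty}\ \sup_{a\in\mathbb R}\left|\mathbb P\left(\frac{Gut(PG_n)-\mathbb E\big(Gut(PG_n)\big)}{\sqrt{\mathrm{Var}\big(Gut(PG_n)\big)}}\le a\right)-\int_{-\infty}^a\frac1{\sqrt{2\pi}}e^{-t^2/2}\,dt\right|=0.$$ -/

import Mathlib

open MeasureTheory ProbabilityTheory Filter Topology

/-- The Gutman index `½ ∑_u ∑_v d(u) d(v) d(u,v)` of a finite graph. -/
noncomputable def gutmanIndex {V : Type*} [Fintype V] (G : SimpleGraph V)
    [DecidableRel G.Adj] : ℝ :=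
  (1 / 2 : ℝ) * ∑ x : V, ∑ y : V, (G.degree x : ℝ) * (G.degree y : ℝ) * (G.dist x y : ℝ)

/-- The pentagonal chain with `n` pentagons `O_1, …, O_n`. The vertex `(k, i)` is the vertex
`x_{i+1}` of the pentagon `O_{k+1}`, where `x_1, …, x_5` is the cyclic labelling of a pentagon.
Consecutive pentagons are joined by one edge: `x_1` of `O_{k+2}` is adjacent to the vertex with
index `u (k+1)` of `O_{k+1}`. -/
def pentagonChain (u : ℕ → Fin 5) (n : ℕ) : SimpleGraph (Fin n × Fin 5) where
  Adj v w :=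
    (v.1 = w.1 ∧ (SimpleGraph.cycleGraph 5).Adj v.2 w.2) ∨
    ((v.1 : ℕ) + 1 = (w.1 : ℕ) ∧ v.2 = u ((v.1 : ℕ) + 1) ∧ w.2 = 0) ∨
    ((w.1 : ℕ) + 1 = (v.1 : ℕ) ∧ w.2 = u ((w.1 : ℕ) + 1) ∧ v.2 = 0)
  symm := ⟨by
    rintro v w (⟨h1, h2⟩ | h | h)
    · exact Or.inl ⟨h1.symm, h2.symm⟩
    · exact Or.inr (Or.inr h)
    · exact Or.inr (Or.inl h)⟩
  loopless := ⟨by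
    rintro v (⟨_, h⟩ | ⟨h, _⟩ | ⟨h, _⟩)
    · exact (SimpleGraph.cycleGraph 5).irrefl h
    · omega
    · omega⟩

instance (u : ℕ → Fin 5) (n : ℕ) : DecidableRel (pentagonChain u n).Adj := fun v w =>
  inferInstanceAs (Decidable (
    (v.1 = w.1 ∧ (SimpleGraph.cycleGraph 5).Adj v.2 w.2) ∨
    ((v.1 : ℕ) + 1 = (w.1 : ℕ) ∧ v.2 = u ((v.1 : ℕ) + 1) ∧ w.2 = 0) ∨
    ((w.1 : ℕ) + 1 = (v.1 : ℕ) ∧ w.2 = u ((w.1 : ℕ) + 1) ∧ v.2 = 0)))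

section RandomChain

variable {Ω : Type*}

/-- `Gut(PG_n)`, for random attachment vertices `u n ω` of `O_n`. -/
noncomputable def gutPG (u : ℕ → Ω → Fin 5) (n : ℕ) (ω : Ω) : ℝ :=
  gutmanIndex (pentagonChain (fun k => u k ω) n)

/-- `Z¹_n`: the indicator of attaching `O_{n+1}` at `x_2` or `x_5` of `O_n`. -/
def choiceOne (u : ℕ → Ω → Fin 5) (n : ℕ) (ω : Ω) : ℝ :=
  if u n ω = 1 ∨ u n ω = 4 then 1 else 0

/-- `Z²_n`: the indicator of attaching `O_{n+1}` at `x_3` or `x_4` of `O_n`. -/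
def choiceTwo (u : ℕ → Ω → Fin 5) (n : ℕ) (ω : Ω) : ℝ :=
  if u n ω = 2 ∨ u n ω = 3 then 1 else 0

/-- `U_n = 288 Z¹_n + 432 Z²_n`. -/
noncomputable def stepU (u : ℕ → Ω → Fin 5) (n : ℕ) (ω : Ω) : ℝ :=
  288 * choiceOne u n ω + 432 * choiceTwo u n ω

/-- `V_n = 156 Z¹_n + 300 Z²_n`. -/
noncomputable def stepV (u : ℕ → Ω → Fin 5) (n : ℕ) (ω : Ω) : ℝ :=
  156 * choiceOne u n ω + 300 * choiceTwo u n ω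

end RandomChain

/-- `σ₁²` as a function of `p₁`. -/
def sigmaSq (p : ℝ) : ℝ :=
  288 ^ 2 * p + 432 ^ 2 * (1 - p) - (288 * p + 432 * (1 - p)) ^ 2

/-- `σ̃₁²` as a function of `p₁`. -/
def sigmaTildeSq (p : ℝ) : ℝ :=
  156 ^ 2 * p + 300 ^ 2 * (1 - p) - (156 * p + 300 * (1 - p)) ^ 2

/-- `r₁` as a function of `p₁`. -/
def covR (p : ℝ) : ℝ :=
  288 * 156 * p + 432 * 300 * (1 - p) -
    (288 * p + 432 * (1 - p)) * (156 * p + 300 * (1 - p))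

/-! The chain is a tree of pentagons, so a shortest path crosses each intermediate link once and
traverses each pentagon between the gates pointing to its two ends. Hence a distance is a difference
of levels plus a sum over pentagons of distances between gates (`pentagonChain_dist`).

Fix the pentagon with zero-based index `m` and push the degree weights of all vertices onto it
through the gates. Every vertex gets 2, its `x_1` gets a further 12m, its attachment vertex a
further 12(n-1-m). The resulting quadratic form is constant except for 288m(n-1-m)d(x_1,u), where u
is the attachment vertex and d(x_1,u) = 1 + Z² when u ≠ `x_1`. So the Gutman index is a
deterministic term plus the sum of 144m(n-1-m)Z² over 0 < m < n-1, a weighted sum of independent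
Bernoulli variables.

The variance is then 144²p₁(1-p₁)((n-1)⁵-(n-1))/30. Since U, V and 144Z² differ by constants, both
variances and the covariance in the statement equal 144²p₁(1-p₁), and the stated polynomial
collapses to this.

Each squared coefficient is O(n⁴) against a variance of order n⁵, so no summand dominates. Comparing
characteristic functions factor by factor with Gaussian ones gives the central limit theorem
(`tendsto_charFun_weighted_sum`), and Pólya's theorem makes the convergence uniform. -/

/-- A function that vanishes exactly at `a`, is 1-Lipschitz along edges, and can be decreased by
one along some edge wherever it is positive, is the distance to `a`. -/
theorem SimpleGraph.dist_eq_of_lipschitz_of_descent {V : Type*} (G : SimpleGraph V) (a : V)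
    (f : V → ℕ) (hzero : f a = 0) (hlip : ∀ v w, G.Adj v w → f w ≤ f v + 1)
    (hdesc : ∀ v, v ≠ a → ∃ w, G.Adj v w ∧ f w + 1 = f v) (b : V) : G.dist a b = f b := by
  have hwalk : ∀ k b, f b = k → ∃ p : G.Walk b a, p.length = k := by
    intro k
    induction k with
    | zero =>
      intro b hb
      by_cases hba : b = a
      · subst hba; exact ⟨.nil, rfl⟩
      · obtain ⟨w, -, hw⟩ := hdesc b hba
        omega
    | succ k ih =>
      intro b hb
      have hba : b ≠ a := by rintro rfl; omega
      obtain ⟨w, hadj, hw⟩ := hdesc b hba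
      obtain ⟨p, hp⟩ := ih w (by omega)
      exact ⟨.cons hadj p, by simp [hp]⟩
  have hbound : ∀ {x y : V} (p : G.Walk x y), f y ≤ f x + p.length := by
    intro x y p
    induction p with
    | nil => simp
    | cons h p ih =>
      have := hlip _ _ h
      simp only [SimpleGraph.Walk.length_cons]
      omega
  obtain ⟨p, hp⟩ := hwalk _ b rfl
  apply le_antisymm
  · rw [SimpleGraph.dist_comm, ← hp]
    exact SimpleGraph.dist_le p
  · have hreach : G.Reachable a b := ⟨p.reverse⟩
    obtain ⟨q, hq⟩ := hreach.exists_walk_length_eq_dist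
    have := hbound q
    omega

/-! ### Distances in a pentagonal chain -/

/-- The distance in a pentagon. -/
def pentagonDist (x y : Fin 5) : ℕ := min (x - y).val (y - x).val

theorem pentagonDist_self (x : Fin 5) : pentagonDist x x = 0 := by
  revert x; decide

theorem pentagonDist_comm (x y : Fin 5) : pentagonDist x y = pentagonDist y x :=
  min_comm _ _

theorem pentagonDist_le_of_adj : ∀ x y z : Fin 5, (SimpleGraph.cycleGraph 5).Adj y z →
    pentagonDist x z ≤ pentagonDist x y + 1 := by decide

theorem exists_adj_pentagonDist : ∀ x y : Fin 5, y ≠ x →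
    ∃ z, (SimpleGraph.cycleGraph 5).Adj y z ∧ pentagonDist x z + 1 = pentagonDist x y := by
  decide

theorem sum_pentagonDist : ∀ x : Fin 5, ∑ y, pentagonDist x y = 6 := by decide

/-- The gate of the pentagon `m` towards the vertex `(k, x)`, where `a m` is the vertex of the
pentagon `m` at which the next pentagon is attached. -/
def chainGate (a : ℕ → Fin 5) (m k : ℕ) (x : Fin 5) : Fin 5 :=
  if k < m then 0 else if k = m then x else a m

theorem chainGate_self (a : ℕ → Fin 5) (m : ℕ) (x : Fin 5) : chainGate a m m x = x := by
  simp [chainGate]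

theorem chainGate_of_lt (a : ℕ → Fin 5) {m k : ℕ} (h : k < m) (x : Fin 5) :
    chainGate a m k x = 0 := by
  simp [chainGate, h]

theorem chainGate_of_gt (a : ℕ → Fin 5) {m k : ℕ} (h : m < k) (x : Fin 5) :
    chainGate a m k x = a m := by
  simp [chainGate, h.not_gt, h.ne']

theorem chainGate_of_ne (a : ℕ → Fin 5) {m k : ℕ} (h : k ≠ m) (x y : Fin 5) :
    chainGate a m k x = chainGate a m k y := by
  simp [chainGate, h]

/-- The two ends of a link have the same gate in every pentagon, so crossing a link changes only the
level. -/
theorem chainGate_succ (a : ℕ → Fin 5) (m k : ℕ) :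
    chainGate a m (k + 1) 0 = chainGate a m k (a k) := by
  rcases lt_trichotomy k m with h | h | h
  · rw [chainGate_of_lt a h]
    rcases (Nat.succ_le_of_lt h).lt_or_eq with h' | h'
    · exact chainGate_of_lt a h' _
    · subst h'; exact chainGate_self a _ _
  · subst h
    rw [chainGate_self, chainGate_of_gt a (Nat.lt_succ_self _)]
  · rw [chainGate_of_gt a h, chainGate_of_gt a (by omega)]

/-- The distance between two vertices of a pentagonal chain. -/
def chainDist (a : ℕ → Fin 5) (n : ℕ) (v w : Fin n × Fin 5) : ℕ :=
  Nat.dist v.1 w.1 +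
    ∑ m ∈ Finset.range n, pentagonDist (chainGate a m v.1 v.2) (chainGate a m w.1 w.2)

/-- Moving inside pentagon `k` affects only the summand `m = k`. The additive form avoids truncated
subtraction. -/
theorem chainDist_same (a : ℕ → Fin 5) (n : ℕ) (v : Fin n × Fin 5) (k : Fin n) (x y : Fin 5) :
    chainDist a n v (k, x) + pentagonDist (chainGate a k v.1 v.2) y =
      chainDist a n v (k, y) + pentagonDist (chainGate a k v.1 v.2) x := by
  unfold chainDist
  rw [← Finset.add_sum_erase _ _ (Finset.mem_range.2 k.2),
    ← Finset.add_sum_erase _ _ (Finset.mem_range.2 k.2)]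
  have : ∑ m ∈ (Finset.range n).erase k,
        pentagonDist (chainGate a m v.1 v.2) (chainGate a m k x) =
      ∑ m ∈ (Finset.range n).erase k,
        pentagonDist (chainGate a m v.1 v.2) (chainGate a m k y) :=
    Finset.sum_congr rfl fun m hm => by
      rw [chainGate_of_ne a (Finset.ne_of_mem_erase hm).symm x y]
  simp only [this, chainGate_self]
  ring

theorem chainDist_link (a : ℕ → Fin 5) (n : ℕ) (v : Fin n × Fin 5) (k l : Fin n)
    (h : (k : ℕ) + 1 = l) :
    chainDist a n v (l, 0) + Nat.dist v.1 k = chainDist a n v (k, a k) + Nat.dist v.1 l := by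
  unfold chainDist
  simp only [← h, chainGate_succ]
  ring

theorem pentagonChain_dist (u : ℕ → Fin 5) (n : ℕ) (v w : Fin n × Fin 5) :
    (pentagonChain u n).dist v w = chainDist (fun m => u (m + 1)) n v w := by
  refine SimpleGraph.dist_eq_of_lipschitz_of_descent _ v
    (chainDist (fun m => u (m + 1)) n v) ?_ ?_ ?_ w
  · simp [chainDist, pentagonDist_self]
  · rintro ⟨k, x⟩ ⟨l, y⟩ (⟨h1, h2⟩ | ⟨h1, h2, h3⟩ | ⟨h1, h2, h3⟩)
    · obtain rfl : k = l := h1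
      have h := chainDist_same (fun m => u (m + 1)) n v k x y
      have h' := pentagonDist_le_of_adj (chainGate (fun m => u (m + 1)) k v.1 v.2) x y h2
      omega
    · simp only at h1 h2 h3
      subst h2 h3
      have h := chainDist_link (fun m => u (m + 1)) n v k l h1
      unfold Nat.dist at h
      omega
    · simp only at h1 h2 h3
      subst h2 h3
      have h := chainDist_link (fun m => u (m + 1)) n v l k h1
      unfold Nat.dist at h
      omega
  · rintro ⟨k, x⟩ hne
    -- Descent towards `v`: at the gate, cross the link on the side of `v`; elsewhere, step towards
    -- the gate within the pentagon.
    by_cases hx : x = chainGate (fun m => u (m + 1)) k v.1 v.2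
    · rcases lt_trichotomy (v.1 : ℕ) k with h | h | h
      · rw [chainGate_of_lt _ h] at hx
        subst hx
        let l : Fin n := ⟨k - 1, by omega⟩
        have hl : (l : ℕ) + 1 = k := by simp only [l]; omega
        refine ⟨(l, u (l + 1)), Or.inr (Or.inr ⟨hl, rfl, rfl⟩), ?_⟩
        have h' := chainDist_link (fun m => u (m + 1)) n v l k hl
        unfold Nat.dist at h'
        omega
      · rw [h, chainGate_self] at hx
        exact absurd (Prod.ext (Fin.ext h.symm) hx) hne
      · rw [chainGate_of_gt _ h] at hx
        subst hx
        let l : Fin n := ⟨k + 1, by omega⟩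
        refine ⟨(l, 0), Or.inr (Or.inl ⟨rfl, rfl, rfl⟩), ?_⟩
        have h' := chainDist_link (fun m => u (m + 1)) n v k l rfl
        have hl : (l : ℕ) = k + 1 := rfl
        unfold Nat.dist at h'
        omega
    · obtain ⟨z, hz, hd⟩ := exists_adj_pentagonDist _ _ hx
      refine ⟨(k, z), Or.inl ⟨rfl, hz⟩, ?_⟩
      have h := chainDist_same (fun m => u (m + 1)) n v k x z
      omega

/-! ### Degrees and the closed form of the Gutman index -/

theorem pentagonChain_degree (u : ℕ → Fin 5) (n : ℕ) (k : Fin n) (x : Fin 5) :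
    (pentagonChain u n).degree (k, x) =
      2 + (if 0 < (k : ℕ) ∧ x = 0 then 1 else 0) +
        (if (k : ℕ) + 1 < n ∧ x = u (k + 1) then 1 else 0) := by
  classical
  -- Neighbours in the same, the previous and the next pentagon; these sets are disjoint, so the two
  -- link contributions add up even at a common vertex.
  let A : Finset (Fin n × Fin 5) := {((k, x + 1) : Fin n × Fin 5), (k, x - 1)}
  let B : Finset (Fin n × Fin 5) := if h : 0 < (k : ℕ) ∧ x = 0 then
    {((⟨k - 1, by omega⟩ : Fin n), u k)} else ∅
  let C : Finset (Fin n × Fin 5) := if h : (k : ℕ) + 1 < n ∧ x = u (k + 1) then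
    {((⟨k + 1, h.1⟩ : Fin n), 0)} else ∅
  have hcycle : ∀ y, (SimpleGraph.cycleGraph 5).Adj x y ↔ y = x + 1 ∨ y = x - 1 := by
    revert x; decide
  have hA : ∀ w ∈ A, w.1 = k := by simp [A]
  have hB : ∀ w ∈ B, (w.1 : ℕ) + 1 = k := by
    intro w hw
    simp only [B] at hw
    split_ifs at hw with h
    · simp only [Finset.mem_singleton] at hw
      subst hw
      simp only
      omega
    · simp at hw
  have hC : ∀ w ∈ C, (w.1 : ℕ) = k + 1 := by
    intro w hw
    simp only [C] at hw
    split_ifs at hw with h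
    · simp only [Finset.mem_singleton] at hw
      subst hw
      rfl
    · simp at hw
  have hset : (pentagonChain u n).neighborFinset (k, x) = (A ∪ B) ∪ C := by
    ext ⟨l, y⟩
    rw [SimpleGraph.mem_neighborFinset, Finset.mem_union, Finset.mem_union]
    have hAmem : (l, y) ∈ A ↔ k = l ∧ (SimpleGraph.cycleGraph 5).Adj x y := by
      simp only [A, hcycle, Finset.mem_insert, Finset.mem_singleton, Prod.mk.injEq]
      tauto
    have hBmem : (l, y) ∈ B ↔ (l : ℕ) + 1 = k ∧ y = u (l + 1) ∧ x = 0 := by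
      simp only [B]
      split_ifs with h
      · simp only [Finset.mem_singleton, Prod.mk.injEq, Fin.ext_iff (n := n)]
        constructor
        · rintro ⟨h1, h2⟩
          have : (l : ℕ) + 1 = k := by omega
          refine ⟨this, ?_, h.2⟩
          rw [this]; exact h2
        · rintro ⟨h1, h2, -⟩
          refine ⟨by omega, ?_⟩
          rw [h2, h1]
      · simp only [Finset.notMem_empty, false_iff]
        rintro ⟨h1, -, h3⟩
        exact h ⟨by omega, h3⟩
    have hCmem : (l, y) ∈ C ↔ (k : ℕ) + 1 = l ∧ x = u (k + 1) ∧ y = 0 := by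
      simp only [C]
      split_ifs with h
      · simp only [Finset.mem_singleton, Prod.mk.injEq]
        constructor
        · rintro ⟨h1, h2⟩
          exact ⟨by rw [h1], h.2, h2⟩
        · rintro ⟨h1, -, h3⟩
          exact ⟨Fin.ext h1.symm, h3⟩
      · simp only [Finset.notMem_empty, false_iff]
        rintro ⟨h1, h2, -⟩
        exact h ⟨by omega, h2⟩
    rw [hAmem, hBmem, hCmem]
    exact (or_congr_right or_comm).trans or_assoc.symm
  have hAB : Disjoint A B := Finset.disjoint_left.2 fun w h1 h2 => by
    have e1 := hA w h1
    have e2 := hB w h2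
    rw [e1] at e2
    omega
  have hABC : Disjoint (A ∪ B) C := Finset.disjoint_left.2 fun w h1 h2 => by
    have e2 := hC w h2
    rcases Finset.mem_union.1 h1 with h1 | h1
    · have e1 := hA w h1
      rw [e1] at e2
      omega
    · have e1 := hB w h1
      omega
  have hAcard : A.card = 2 := by
    rw [Finset.card_pair]
    simp only [ne_eq, Prod.mk.injEq, true_and]
    exact (by decide : ∀ x : Fin 5, ¬ x + 1 = x - 1) x
  rw [← SimpleGraph.card_neighborFinset_eq_degree, hset, Finset.card_union_of_disjoint hABC,
    Finset.card_union_of_disjoint hAB, hAcard]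
  congr 1
  · congr 1
    simp only [B]
    split_ifs <;> simp
  · simp only [C]
    split_ifs <;> simp

/-- The degree of the vertex `(k, x)` of a pentagonal chain with `n` pentagons. -/
noncomputable def chainWeight (a : ℕ → Fin 5) (n k : ℕ) (x : Fin 5) : ℝ :=
  2 + (if 0 < k ∧ x = 0 then 1 else 0) + (if k + 1 < n ∧ x = a k then 1 else 0)

theorem sum_chainWeight_mul (a : ℕ → Fin 5) (n k : ℕ) (g : Fin 5 → ℝ) :
    ∑ x, chainWeight a n k x * g x =
      2 * ∑ x, g x + (if 0 < k then 1 else 0) * g 0 + (if k + 1 < n then 1 else 0) * g (a k) := by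
  simp only [chainWeight, add_mul, Finset.sum_add_distrib, Finset.mul_sum, ite_and, ite_mul,
    one_mul, zero_mul]
  congr 1
  · congr 1
    split_ifs <;> simp
  · split_ifs <;> simp

/-- A pentagon with links on both sides has total degree 12; the correction is the missing incoming
link of the first one. -/
theorem sum_range_pentagonWeight {m n : ℕ} (h : m < n) :
    ∑ k ∈ Finset.range m, ((10 : ℝ) + (if 0 < k then 1 else 0) + (if k + 1 < n then 1 else 0)) =
      12 * m - (if 0 < m then 1 else 0) := by
  induction m with
  | zero => simp
  | succ m ih =>
    rw [Finset.sum_range_succ, ih (by omega), if_pos h, if_pos (Nat.succ_pos m)]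
    push_cast
    ring

theorem sum_Ico_pentagonWeight {m n : ℕ} (h : m < n) :
    ∑ k ∈ Finset.Ico (m + 1) n,
        ((10 : ℝ) + (if 0 < k then 1 else 0) + (if k + 1 < n then 1 else 0)) =
      12 * (n - 1 - m) - (if m + 1 < n then 1 else 0) := by
  obtain ⟨d, rfl⟩ := Nat.exists_eq_add_of_le (Nat.succ_le_of_lt h)
  rw [Finset.sum_Ico_eq_sum_range, show m.succ + d - (m + 1) = d by omega]
  cases d with
  | zero => simp
  | succ d =>
    rw [Finset.sum_range_succ, if_pos (by omega : m + 1 < m.succ + (d + 1)),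
      Finset.sum_congr rfl (g := fun _ => (12 : ℝ)) fun i hi => by
        rw [Finset.mem_range] at hi
        rw [if_pos (by omega), if_pos (by omega)]
        norm_num]
    rw [if_pos (by omega), if_neg (by omega)]
    simp
    ring

/-- All earlier pentagons project to `0` and all later ones to `a m`. The end corrections -1 in
their total degrees are cancelled by the link degrees of pentagon `m` itself. -/
theorem sum_chainWeight_mul_gate (a : ℕ → Fin 5) {m n : ℕ} (h : m < n) (g : Fin 5 → ℝ) :
    ∑ k ∈ Finset.range n, ∑ x, chainWeight a n k x * g (chainGate a m k x) =
      2 * ∑ x, g x + 12 * m * g 0 + 12 * (n - 1 - m) * g (a m) := by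
  have hconst : ∀ k : ℕ, ∀ c : ℝ, ∑ x, chainWeight a n k x * c =
      ((10 : ℝ) + (if 0 < k then 1 else 0) + (if k + 1 < n then 1 else 0)) * c := by
    intro k c
    rw [sum_chainWeight_mul a n k fun _ => c]
    simp only [Finset.sum_const, Finset.card_univ, Fintype.card_fin, nsmul_eq_mul]
    push_cast
    ring
  rw [← Finset.sum_range_add_sum_Ico _ h.le, Finset.sum_eq_sum_Ico_succ_bot h,
    Finset.sum_congr rfl (g := fun k => ((10 : ℝ) + (if 0 < k then 1 else 0) +
      (if k + 1 < n then 1 else 0)) * g 0) fun k hk => by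
        rw [← hconst]
        simp only [chainGate_of_lt a (Finset.mem_range.1 hk)],
    Finset.sum_congr (s₁ := Finset.Ico (m + 1) n) rfl
      (g := fun k => ((10 : ℝ) + (if 0 < k then 1 else 0) +
      (if k + 1 < n then 1 else 0)) * g (a m)) fun k hk => by
        rw [← hconst]
        simp only [chainGate_of_gt a (Finset.mem_Ico.1 hk).1],
    ← Finset.sum_mul, ← Finset.sum_mul, sum_range_pentagonWeight h, sum_Ico_pentagonWeight h]
  simp only [chainGate_self]
  rw [sum_chainWeight_mul]
  ring

theorem sum_sum_chainWeight_pentagonDist (a : ℕ → Fin 5) {m n : ℕ} (h : m < n) :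
    ∑ k ∈ Finset.range n, ∑ x, ∑ l ∈ Finset.range n, ∑ y,
      chainWeight a n k x * chainWeight a n l y *
        (pentagonDist (chainGate a m k x) (chainGate a m l y) : ℝ) =
      120 + 288 * (n - 1) + 288 * (m * (n - 1 - m) * (pentagonDist 0 (a m) : ℝ)) := by
  have hsum : ∀ z, ∑ y, (pentagonDist z y : ℝ) = 6 := by
    intro z
    exact_mod_cast sum_pentagonDist z
  have hsum' : ∀ z, ∑ y, (pentagonDist y z : ℝ) = 6 := by
    intro z
    simp only [pentagonDist_comm _ z, hsum]
  have hinner : ∀ z, ∑ l ∈ Finset.range n, ∑ y,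
      chainWeight a n l y * (pentagonDist z (chainGate a m l y) : ℝ) =
        12 + 12 * m * (pentagonDist z 0 : ℝ) + 12 * (n - 1 - m) * (pentagonDist z (a m) : ℝ) := by
    intro z
    rw [sum_chainWeight_mul_gate a h fun y => (pentagonDist z y : ℝ), hsum]
    norm_num
  simp only [mul_assoc (chainWeight a n _ _) (chainWeight a n _ _), ← Finset.mul_sum, hinner]
  rw [sum_chainWeight_mul_gate a h fun z => 12 + 12 * m * (pentagonDist z 0 : ℝ) +
    12 * (n - 1 - m) * (pentagonDist z (a m) : ℝ)]
  simp only [Finset.sum_add_distrib, ← Finset.mul_sum, hsum', pentagonDist_self,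
    pentagonDist_comm (a m) 0]
  simp
  ring

/-- The part of the Gutman index of a pentagonal chain that does not depend on the attachment
vertices. -/
noncomputable def gutmanConst (n : ℕ) : ℝ :=
  (1 / 2) * ∑ k ∈ Finset.range n, ∑ l ∈ Finset.range n,
    ((10 : ℝ) + (if 0 < k then 1 else 0) + (if k + 1 < n then 1 else 0)) *
      ((10 : ℝ) + (if 0 < l then 1 else 0) + (if l + 1 < n then 1 else 0)) * (Nat.dist k l : ℝ) +
    n * (60 + 144 * (n - 1))

/-- Exchanging the sum over vertex pairs with the sum over pentagons leaves one quadratic form per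
pentagon. `gutmanConst` needs no evaluation, as it cancels on centering. -/
theorem gutmanIndex_pentagonChain (u : ℕ → Fin 5) (n : ℕ) :
    gutmanIndex (pentagonChain u n) = gutmanConst n +
      ∑ m ∈ Finset.range n, 144 * (m * (n - 1 - m) * (pentagonDist 0 (u (m + 1)) : ℝ)) := by
  have hdeg : ∀ v : Fin n × Fin 5, ((pentagonChain u n).degree v : ℝ) =
      chainWeight (fun m => u (m + 1)) n v.1 v.2 := by
    rintro ⟨k, x⟩
    rw [pentagonChain_degree, chainWeight]
    push_cast
    rfl
  have hconst : ∀ k : ℕ, ∑ x, chainWeight (fun m => u (m + 1)) n k x =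
      ((10 : ℝ) + (if 0 < k then 1 else 0) + (if k + 1 < n then 1 else 0)) := by
    intro k
    have := sum_chainWeight_mul (fun m => u (m + 1)) n k fun _ => 1
    simp only [mul_one] at this
    rw [this]
    simp
    norm_num
  have hrange : ∀ f : ℕ → Fin 5 → ℕ → Fin 5 → ℝ,
      ∑ k : Fin n, ∑ x, ∑ l : Fin n, ∑ y, f k x l y =
        ∑ k ∈ Finset.range n, ∑ x, ∑ l ∈ Finset.range n, ∑ y, f k x l y := by
    intro f
    rw [← Fin.sum_univ_eq_sum_range fun k => ∑ x, ∑ l ∈ Finset.range n, ∑ y, f k x l y]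
    refine Finset.sum_congr rfl fun k _ => Finset.sum_congr rfl fun x _ => ?_
    rw [← Fin.sum_univ_eq_sum_range fun l => ∑ y, f k x l y]
  have hgate : ∑ k ∈ Finset.range n, ∑ x, ∑ l ∈ Finset.range n, ∑ y,
      chainWeight (fun m => u (m + 1)) n k x * chainWeight (fun m => u (m + 1)) n l y *
        ∑ m ∈ Finset.range n, (pentagonDist (chainGate (fun m => u (m + 1)) m k x)
          (chainGate (fun m => u (m + 1)) m l y) : ℝ) =
      ∑ m ∈ Finset.range n, (120 + 288 * ((n : ℝ) - 1) +
        288 * (m * (n - 1 - m) * (pentagonDist 0 (u (m + 1)) : ℝ))) := by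
    rw [Finset.sum_congr rfl fun m hm =>
      (sum_sum_chainWeight_pentagonDist (fun m => u (m + 1)) (Finset.mem_range.1 hm)).symm]
    simp only [Finset.mul_sum]
    symm
    rw [Finset.sum_comm]
    refine Finset.sum_congr rfl fun k _ => ?_
    rw [Finset.sum_comm]
    refine Finset.sum_congr rfl fun x _ => ?_
    rw [Finset.sum_comm]
    refine Finset.sum_congr rfl fun l _ => ?_
    rw [Finset.sum_comm]
  have hlevel : ∑ k ∈ Finset.range n, ∑ x, ∑ l ∈ Finset.range n, ∑ y,
      chainWeight (fun m => u (m + 1)) n k x * chainWeight (fun m => u (m + 1)) n l y *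
        (Nat.dist k l : ℝ) =
      ∑ k ∈ Finset.range n, ∑ l ∈ Finset.range n,
        ((10 : ℝ) + (if 0 < k then 1 else 0) + (if k + 1 < n then 1 else 0)) *
          ((10 : ℝ) + (if 0 < l then 1 else 0) + (if l + 1 < n then 1 else 0)) *
            (Nat.dist k l : ℝ) := by
    refine Finset.sum_congr rfl fun k _ => ?_
    rw [Finset.sum_comm]
    refine Finset.sum_congr rfl fun l _ => ?_
    rw [← hconst, ← hconst, Finset.sum_mul_sum, Finset.sum_mul]
    exact Finset.sum_congr rfl fun x _ => (Finset.sum_mul _ _ _).symm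
  unfold gutmanIndex
  simp only [hdeg, pentagonChain_dist, chainDist, Fintype.sum_prod_type]
  rw [hrange fun k x l y => chainWeight (fun m => u (m + 1)) n k x *
    chainWeight (fun m => u (m + 1)) n l y * ((Nat.dist k l +
      ∑ m ∈ Finset.range n, pentagonDist (chainGate (fun m => u (m + 1)) m k x)
        (chainGate (fun m => u (m + 1)) m l y) : ℕ) : ℝ)]
  push_cast
  simp only [mul_add, Finset.sum_add_distrib] at hgate hlevel ⊢
  rw [hgate, hlevel, gutmanConst]
  simp only [mul_add, ← Finset.mul_sum, Finset.sum_const, Finset.card_range, nsmul_eq_mul]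
  ring

/-! ### Central limit theorem for weighted sums -/

/-- Replace the factors one at a time; the untouched ones have norm at most 1. -/
theorem Finset.norm_prod_sub_prod_le {ι : Type*} (s : Finset ι) (f g : ι → ℂ)
    (hf : ∀ i ∈ s, ‖f i‖ ≤ 1) (hg : ∀ i ∈ s, ‖g i‖ ≤ 1) :
    ‖∏ i ∈ s, f i - ∏ i ∈ s, g i‖ ≤ ∑ i ∈ s, ‖f i - g i‖ := by
  classical
  induction s using Finset.induction with
  | empty => simp
  | insert a s ha ih =>
    rw [Finset.prod_insert ha, Finset.prod_insert ha, Finset.sum_insert ha]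
    have h1 := ih (fun i hi => hf i (Finset.mem_insert_of_mem hi))
      (fun i hi => hg i (Finset.mem_insert_of_mem hi))
    have h2 : ‖∏ i ∈ s, g i‖ ≤ 1 := by
      rw [norm_prod]
      exact Finset.prod_le_one (fun _ _ => norm_nonneg _)
        fun i hi => hg i (Finset.mem_insert_of_mem hi)
    calc ‖f a * ∏ i ∈ s, f i - g a * ∏ i ∈ s, g i‖
        = ‖(f a - g a) * ∏ i ∈ s, g i + f a * (∏ i ∈ s, f i - ∏ i ∈ s, g i)‖ := by ring_nf
      _ ≤ ‖f a - g a‖ * ‖∏ i ∈ s, g i‖ + ‖f a‖ * ‖∏ i ∈ s, f i - ∏ i ∈ s, g i‖ := by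
        refine (norm_add_le _ _).trans ?_
        rw [norm_mul, norm_mul]
      _ ≤ ‖f a - g a‖ * 1 + 1 * ‖∏ i ∈ s, f i - ∏ i ∈ s, g i‖ := by
        gcongr
        exact hf a (Finset.mem_insert_self _ _)
      _ ≤ _ := by linarith

theorem taylor_charFun_gaussianReal_two :
    (fun t : ℝ => charFun (gaussianReal 0 1) t - (1 - t ^ 2 / 2)) =o[𝓝 0] fun t : ℝ => t ^ 2 := by
  have h0 : (gaussianReal 0 1)[(id : ℝ → ℝ)] = 0 := integral_id_gaussianReal
  have hvar : Var[(id : ℝ → ℝ); gaussianReal 0 1] = 1 := by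
    rw [variance_id_gaussianReal]; rfl
  have h1 : (gaussianReal 0 1)[(id : ℝ → ℝ) ^ 2] = 1 := by
    rw [← hvar, variance_of_integral_eq_zero aemeasurable_id h0]
    rfl
  simpa using taylor_charFun_two aemeasurable_id h0 h1

section WeightedSum

variable {Ω : Type*} [MeasurableSpace Ω] {P : Measure Ω} [IsProbabilityMeasure P]

/-- Characteristic functions of weighted sums of independent identically distributed, centered
random variables of variance `1`: if the squares of the weights sum to `1` and the largest weight
tends to zero, they converge to that of the standard Gaussian. -/
theorem tendsto_charFun_weighted_sum {X : ℕ → Ω → ℝ} (hindep : iIndepFun X P)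
    (hident : ∀ i, IdentDistrib (X i) (X 0) P P) (h0 : P[X 0] = 0) (h1 : P[X 0 ^ 2] = 1)
    (s : ℕ → Finset ℕ) (w : ℕ → ℕ → ℝ) (hw : ∀ᶠ n in atTop, ∑ i ∈ s n, w n i ^ 2 = 1)
    (hmax : ∀ ε > 0, ∀ᶠ n in atTop, ∀ i ∈ s n, |w n i| ≤ ε) (t : ℝ) :
    Tendsto (fun n => charFun (P.map fun ω => ∑ i ∈ s n, w n i * X i ω) t) atTop
      (𝓝 (charFun (gaussianReal 0 1) t)) := by
  have hX : ∀ i, AEMeasurable (X i) P := fun i => (hident i).aemeasurable_fst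
  have : IsProbabilityMeasure (P.map (X 0)) := Measure.isProbabilityMeasure_map (hX 0)
  have hprod : ∀ n, charFun (P.map fun ω => ∑ i ∈ s n, w n i * X i ω) t =
      ∏ i ∈ s n, charFun (P.map (X 0)) (w n i * t) := by
    intro n
    have hind : iIndepFun (fun i ω => w n i * X i ω) P :=
      hindep.comp (fun i x => w n i * x) (by fun_prop)
    rw [(hind.restrict _).charFun_map_fun_finsetSum_eq_prod fun i _ => (hX i).const_mul _,
      Finset.prod_apply]
    refine Finset.prod_congr rfl fun i _ => ?_
    rw [charFun_map_mul_comp (hX i), (hident i).map_eq]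
  -- The squared weights sum to 1, so the Gaussian characteristic function factors along the same
  -- weights.
  have hgauss : ∀ n, ∑ i ∈ s n, w n i ^ 2 = 1 → charFun (gaussianReal 0 1) t =
      ∏ i ∈ s n, charFun (gaussianReal 0 1) (w n i * t) := by
    intro n hn
    simp only [charFun_gaussianReal]
    rw [← Complex.exp_sum]
    congr 1
    have hn' : ∑ i ∈ s n, (w n i : ℂ) ^ 2 = 1 := by exact_mod_cast hn
    simp only [Complex.ofReal_zero, mul_zero, zero_mul, zero_sub, NNReal.coe_one,
      Complex.ofReal_one, one_mul, Complex.ofReal_mul, mul_pow, Finset.sum_neg_distrib,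
      ← Finset.sum_div, ← Finset.sum_mul, hn']
  have hlittle : (fun x : ℝ => charFun (P.map (X 0)) x - charFun (gaussianReal 0 1) x)
      =o[𝓝 0] fun x : ℝ => x ^ 2 := by
    simpa using (taylor_charFun_two (hX 0) h0 h1).sub taylor_charFun_gaussianReal_two
  rw [Metric.tendsto_nhds]
  intro ε hε
  -- The factorwise errors add up to at most this constant times t², which is below ε.
  have hc : 0 < ε / (t ^ 2 + 1) := by positivity
  obtain ⟨δ, hδ, hball⟩ := Metric.eventually_nhds_iff.1 (hlittle.def hc)
  filter_upwards [hw, hmax (δ / (2 * (|t| + 1))) (by positivity)] with n hn hm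
  rw [dist_eq_norm, hprod, hgauss n hn]
  have hsmall : ∀ i ∈ s n, dist (w n i * t) 0 < δ := by
    intro i hi
    rw [Real.dist_eq, sub_zero, abs_mul]
    calc |w n i| * |t| ≤ δ / (2 * (|t| + 1)) * |t| := by
          gcongr
          exact hm i hi
      _ < δ := by
        rw [div_mul_eq_mul_div, div_lt_iff₀ (by positivity)]
        nlinarith [abs_nonneg t]
  calc _ ≤ ∑ i ∈ s n, ‖charFun (P.map (X 0)) (w n i * t) -
          charFun (gaussianReal 0 1) (w n i * t)‖ :=
        Finset.norm_prod_sub_prod_le _ _ _ (fun _ _ => norm_charFun_le_one _)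
          fun _ _ => norm_charFun_le_one _
    _ ≤ ∑ i ∈ s n, ε / (t ^ 2 + 1) * (w n i ^ 2 * t ^ 2) := by
        refine Finset.sum_le_sum fun i hi => ?_
        have := hball (hsmall i hi)
        rwa [Real.norm_of_nonneg (sq_nonneg _), mul_pow] at this
    _ = ε / (t ^ 2 + 1) * t ^ 2 := by
        rw [← Finset.mul_sum, ← Finset.sum_mul, hn, one_mul]
    _ < ε := by
        rw [div_mul_eq_mul_div, div_lt_iff₀ (by positivity)]
        nlinarith

end WeightedSum

/-! ### Uniform convergence of distribution functions -/

/-- **Pólya's theorem**: pointwise convergence of distribution functions to a continuous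
distribution function is uniform. -/
theorem tendsto_iSup_abs_sub_of_monotone {F : ℕ → ℝ → ℝ} {G : ℝ → ℝ}
    (hF : ∀ n, Monotone (F n)) (hF0 : ∀ n x, 0 ≤ F n x) (hF1 : ∀ n x, F n x ≤ 1)
    (hG : Monotone G) (hGc : Continuous G) (hbot : Tendsto G atBot (𝓝 0))
    (htop : Tendsto G atTop (𝓝 1)) (hlim : ∀ x, Tendsto (fun n => F n x) atTop (𝓝 (G x))) :
    Tendsto (fun n => ⨆ x, |F n x - G x|) atTop (𝓝 0) := by
  have hG0 : ∀ x, 0 ≤ G x := fun x => hG.le_of_tendsto hbot x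
  have hG1 : ∀ x, G x ≤ 1 := fun x => hG.ge_of_tendsto htop x
  have hclose : ∀ x, ∀ ε > 0, ∀ᶠ n in atTop, |F n x - G x| < ε := fun x ε hε =>
    (Metric.tendsto_nhds.1 (hlim x) ε hε).mono fun n hn => by rwa [Real.dist_eq] at hn
  -- By monotonicity, control at the two ends of a short interval controls everything between.
  have hlocal : TendstoLocallyUniformly F G atTop := by
    rw [Metric.tendstoLocallyUniformly_iff]
    intro ε hε x
    obtain ⟨δ, hδ, hδG⟩ := Metric.continuous_iff.1 hGc x (ε / 4) (by positivity)
    have hl := hδG (x - δ / 2) (by rw [Real.dist_eq, abs_lt]; constructor <;> linarith)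
    have hr := hδG (x + δ / 2) (by rw [Real.dist_eq, abs_lt]; constructor <;> linarith)
    rw [Real.dist_eq, abs_lt] at hl hr
    refine ⟨Set.Icc (x - δ / 2) (x + δ / 2), Icc_mem_nhds (by linarith) (by linarith), ?_⟩
    filter_upwards [hclose (x - δ / 2) (ε / 4) (by positivity),
      hclose (x + δ / 2) (ε / 4) (by positivity)] with n h1 h2 y hy
    rw [abs_lt] at h1 h2
    have := hF n hy.1
    have := hF n hy.2
    have := hG hy.1
    have := hG hy.2
    rw [Real.dist_eq, abs_lt]
    constructor <;> linarith
  rw [Metric.tendsto_nhds]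
  intro ε hε
  obtain ⟨a, ha⟩ := (hbot.eventually_lt_const (by positivity : (0 : ℝ) < ε / 4)).exists
  obtain ⟨b, hb⟩ := (htop.eventually_const_lt (by linarith : 1 - ε / 4 < (1 : ℝ))).exists
  have hunif := Metric.tendstoUniformlyOn_iff.1
    ((tendstoLocallyUniformlyOn_iff_tendstoUniformlyOn_of_compact isCompact_Icc).1
      (hlocal.tendstoLocallyUniformlyOn (s := Set.Icc a b))) (ε / 2) (by positivity)
  filter_upwards [hunif, hclose a (ε / 4) (by positivity), hclose b (ε / 4) (by positivity)]
    with n hn h1 h2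
  rw [abs_lt] at h1 h2
  have hle : ⨆ x, |F n x - G x| ≤ ε / 2 := by
    refine ciSup_le fun x => ?_
    rcases lt_or_ge x a with hx | hx
    · have := hF n hx.le
      have := hG hx.le
      have := hF0 n x
      have := hG0 x
      rw [abs_le]
      constructor <;> linarith
    · rcases lt_or_ge b x with hx' | hx'
      · have := hF n hx'.le
        have := hG hx'.le
        have := hF1 n x
        have := hG1 x
        rw [abs_le]
        constructor <;> linarith
      · have := hn x ⟨hx, hx'⟩
        rw [dist_comm, Real.dist_eq] at this
        exact this.le
  rw [Real.dist_eq, sub_zero, abs_of_nonneg (Real.iSup_nonneg fun _ => abs_nonneg _)]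
  linarith

/-- The jump at a point is the mass of that point. -/
theorem continuous_cdf (ν : Measure ℝ) [IsProbabilityMeasure ν] [NullSingletonClass ν] :
    Continuous (cdf ν) := by
  rw [continuous_iff_continuousAt]
  intro x
  rw [(monotone_cdf ν).continuousAt_iff_leftLim_eq_rightLim, StieltjesFunction.rightLim_eq]
  have h := (cdf ν).measure_singleton x
  rw [measure_cdf, measure_singleton, eq_comm, ENNReal.ofReal_eq_zero, sub_nonpos] at h
  exact le_antisymm ((monotone_cdf ν).leftLim_le le_rfl) h

theorem cdf_gaussianReal (a : ℝ) : cdf (gaussianReal 0 1) a =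
    ∫ t in Set.Iic a, 1 / √(2 * Real.pi) * Real.exp (-t ^ 2 / 2) := by
  rw [cdf_eq_real, measureReal_def, gaussianReal_apply_eq_integral 0 one_ne_zero,
    ENNReal.toReal_ofReal (integral_nonneg fun _ => gaussianPDFReal_nonneg _ _ _)]
  simp [gaussianPDFReal]

/-- Convergence of characteristic functions to that of the standard Gaussian implies uniform
convergence of distribution functions. -/
theorem tendsto_iSup_abs_sub_gaussian {Ω : Type*} [MeasurableSpace Ω] {P : Measure Ω}
    [IsProbabilityMeasure P] {Z : ℕ → Ω → ℝ} (hZ : ∀ n, AEMeasurable (Z n) P)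
    (hlim : ∀ t, Tendsto (fun n => charFun (P.map (Z n)) t) atTop
      (𝓝 (charFun (gaussianReal 0 1) t))) :
    Tendsto (fun n => ⨆ a : ℝ, |P.real {ω | Z n ω ≤ a} -
      ∫ t in Set.Iic a, 1 / √(2 * Real.pi) * Real.exp (-t ^ 2 / 2)|) atTop (𝓝 0) := by
  have hprob : ∀ n, IsProbabilityMeasure (P.map (Z n)) :=
    fun n => Measure.isProbabilityMeasure_map (hZ n)
  have : NullSingletonClass (gaussianReal 0 1) := nullSingletonClass_gaussianReal one_ne_zero
  have hcdf : ∀ n a, P.real {ω | Z n ω ≤ a} = cdf (P.map (Z n)) a := by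
    intro n a
    rw [cdf_eq_real, map_measureReal_apply_of_aemeasurable (hZ n) measurableSet_Iic]
    rfl
  simp only [hcdf, ← cdf_gaussianReal]
  refine tendsto_iSup_abs_sub_of_monotone (fun n => monotone_cdf _) (fun n => cdf_nonneg _)
    (fun n => cdf_le_one _) (monotone_cdf _) (continuous_cdf _) (tendsto_cdf_atBot _)
    (tendsto_cdf_atTop _) fun a => ?_
  have hweak : Tendsto (β := ProbabilityMeasure ℝ) (fun n => ⟨P.map (Z n), hprob n⟩) atTop
      (𝓝 ⟨gaussianReal 0 1, inferInstance⟩) :=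
    ProbabilityMeasure.tendsto_iff_tendsto_charFun.2 hlim
  have hset := ProbabilityMeasure.tendsto_measure_of_null_frontier_of_tendsto' hweak
    (E := Set.Iic a) (by simp [measure_singleton])
  simp only [cdf_eq_real, measureReal_def]
  exact (ENNReal.tendsto_toReal (measure_ne_top _ _)).comp hset

/-! ### The Gutman index as a weighted Bernoulli sum -/

theorem pentagonDist_zero_eq_choice {Ω : Type*} (u : ℕ → Ω → Fin 5) (n : ℕ) (ω : Ω) :
    (pentagonDist 0 (u n ω) : ℝ) = choiceOne u n ω + 2 * choiceTwo u n ω := by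
  have h : ∀ x : Fin 5, pentagonDist 0 x =
      (if x = 1 ∨ x = 4 then 1 else 0) + 2 * (if x = 2 ∨ x = 3 then 1 else 0) := by decide
  rw [h, choiceOne, choiceTwo]
  push_cast
  rfl

/-- The coefficient of the `i`-th random choice in the Gutman index of a chain of `n` pentagons. -/
noncomputable def gutmanCoeff (n i : ℕ) : ℝ := 144 * ((i + 1) * (n - 2 - i))

/-- The summands of the first and last pentagons have coefficient 0, so the arbitrary `u 1`
disappears; the index shift is `m = i + 1`. -/
theorem gutPG_eq {Ω : Type*} {u : ℕ → Ω → Fin 5}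
    (hsum : ∀ n, 2 ≤ n → ∀ ω, choiceOne u n ω + choiceTwo u n ω = 1) (n : ℕ) (ω : Ω) :
    gutPG u n ω = (gutmanConst n + ∑ i ∈ Finset.range (n - 2), gutmanCoeff n i) +
      ∑ i ∈ Finset.range (n - 2), gutmanCoeff n i * choiceTwo u (i + 2) ω := by
  rw [gutPG, gutmanIndex_pentagonChain, add_assoc, ← Finset.sum_add_distrib]
  congr 1
  match n with
  | 0 => simp
  | 1 => simp
  | k + 2 =>
    rw [Finset.sum_range_succ, Finset.sum_range_succ']
    simp only [Nat.add_sub_cancel]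
    rw [show ((k + 2 : ℕ) : ℝ) - 1 - ((k + 1 : ℕ) : ℝ) = 0 by push_cast; ring]
    simp only [Nat.cast_zero, zero_mul, mul_zero, add_zero]
    refine Finset.sum_congr rfl fun i _ => ?_
    rw [pentagonDist_zero_eq_choice u (i + 1 + 1) ω, gutmanCoeff]
    have := hsum (i + 2) (by omega) ω
    rw [show choiceOne u (i + 1 + 1) ω = 1 - choiceTwo u (i + 2) ω by linarith]
    push_cast
    ring

/-- Power sums of degrees 2, 3 and 4, with `M` kept independent of `j` so that induction applies. -/
theorem sum_sq_mul_sub_sq (M : ℝ) (j : ℕ) :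
    ∑ i ∈ Finset.range j, (((i : ℝ) + 1) * (M - 1 - i)) ^ 2 =
      M ^ 2 * (j * (j + 1) * (2 * j + 1) / 6) - 2 * M * (j ^ 2 * (j + 1) ^ 2 / 4) +
        j * (j + 1) * (2 * j + 1) * (3 * j ^ 2 + 3 * j - 1) / 30 := by
  induction j with
  | zero => simp
  | succ j ih =>
    rw [Finset.sum_range_succ, ih]
    push_cast
    ring

theorem sum_gutmanCoeff_sq {n : ℕ} (hn : 1 ≤ n) :
    ∑ i ∈ Finset.range (n - 2), gutmanCoeff n i ^ 2 =
      144 ^ 2 * (((n : ℝ) - 1) ^ 5 - (n - 1)) / 30 := by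
  have h : ∀ i : ℕ, gutmanCoeff n i ^ 2 =
      144 ^ 2 * (((i : ℝ) + 1) * (((n : ℝ) - 1) - 1 - i)) ^ 2 := by
    intro i
    rw [gutmanCoeff]
    ring
  simp only [h]
  rw [← Finset.mul_sum, sum_sq_mul_sub_sq]
  match n, hn with
  | 1, _ => simp
  | k + 2, _ =>
    simp only [Nat.add_sub_cancel]
    push_cast
    ring

theorem gutmanCoeff_sq_le {n i : ℕ} (hi : i ∈ Finset.range (n - 2)) :
    gutmanCoeff n i ^ 2 ≤ 144 ^ 2 * ((n : ℝ) - 1) ^ 4 := by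
  rw [Finset.mem_range] at hi
  have hi' : (i : ℝ) + 3 ≤ n := by exact_mod_cast (by omega : i + 3 ≤ n)
  have h0 : (0 : ℝ) ≤ i := Nat.cast_nonneg i
  rw [gutmanCoeff, mul_pow, show ((n : ℝ) - 1) ^ 4 = ((n - 1) * (n - 1)) ^ 2 by ring]
  have h1 : 0 ≤ (n : ℝ) - 2 - i := by linarith
  gcongr ?_ * ?_ ^ 2
  exact mul_le_mul (by linarith) (by linarith) h1 (by linarith)

theorem choiceTwo_eq_zero_or_one {Ω : Type*} (u : ℕ → Ω → Fin 5) (n : ℕ) (ω : Ω) :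
    choiceTwo u n ω = 0 ∨ choiceTwo u n ω = 1 := by
  unfold choiceTwo
  split_ifs <;> simp

/-! ### Moments and limit law of the random index -/

section Chain

variable {Ω : Type*} [MeasurableSpace Ω] {μ : Measure Ω} {p₁ : ℝ} {u : ℕ → Ω → Fin 5}

theorem memLp_choiceTwo [IsProbabilityMeasure μ] {n : ℕ} (hmeas : Measurable (choiceTwo u n)) :
    MemLp (choiceTwo u n) 2 μ :=
  MemLp.of_bound hmeas.aestronglyMeasurable 1 <| ae_of_all _ fun ω => by
    rcases choiceTwo_eq_zero_or_one u n ω with h | h <;> simp [h]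

theorem variance_choiceTwo [IsProbabilityMeasure μ] {n : ℕ} (hmeas : Measurable (choiceTwo u n))
    (hlaw : μ.real {ω | choiceTwo u n ω = 1} = 1 - p₁ ∧ μ.real {ω | choiceTwo u n ω = 0} = p₁) :
    Var[choiceTwo u n; μ] = p₁ * (1 - p₁) := by
  rw [variance_of_ae_eq_zero_or_one hmeas.aemeasurable
    (ae_of_all _ (choiceTwo_eq_zero_or_one u n)), hlaw.1, hlaw.2]

theorem integral_choiceTwo {n : ℕ} (hmeas : Measurable (choiceTwo u n))
    (hlaw : μ.real {ω | choiceTwo u n ω = 1} = 1 - p₁) :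
    ∫ ω, choiceTwo u n ω ∂μ = 1 - p₁ := by
  rw [integral_of_ae_eq_zero_or_one hmeas.aemeasurable
    (ae_of_all _ (choiceTwo_eq_zero_or_one u n)), hlaw]

theorem identDistrib_choiceTwo [IsProbabilityMeasure μ] {m n : ℕ} (hm : Measurable (choiceTwo u m))
    (hn : Measurable (choiceTwo u n))
    (hone : μ.real {ω | choiceTwo u m ω = 1} = μ.real {ω | choiceTwo u n ω = 1})
    (hzero : μ.real {ω | choiceTwo u m ω = 0} = μ.real {ω | choiceTwo u n ω = 0}) :
    IdentDistrib (choiceTwo u m) (choiceTwo u n) μ μ where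
  aemeasurable_fst := hm.aemeasurable
  aemeasurable_snd := hn.aemeasurable
  map_eq := by
    rw [(Measure.ae_eq_or_eq_iff_map_eq_dirac_add_dirac hm.aemeasurable zero_ne_one).1
        (ae_of_all _ (choiceTwo_eq_zero_or_one u m)),
      (Measure.ae_eq_or_eq_iff_map_eq_dirac_add_dirac hn.aemeasurable zero_ne_one).1
        (ae_of_all _ (choiceTwo_eq_zero_or_one u n))]
    have h1 : μ (choiceTwo u m ⁻¹' {1}) = μ (choiceTwo u n ⁻¹' {1}) :=
      (measureReal_eq_measureReal_iff (measure_ne_top _ _) (measure_ne_top _ _)).1 hone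
    have h0 : μ (choiceTwo u m ⁻¹' {0}) = μ (choiceTwo u n ⁻¹' {0}) :=
      (measureReal_eq_measureReal_iff (measure_ne_top _ _) (measure_ne_top _ _)).1 hzero
    rw [h0, h1]

theorem iIndepFun_choiceTwo (hindep : iIndepFun
      (fun (n : {n : ℕ // 2 ≤ n}) (ω : Ω) => (choiceOne u n ω, choiceTwo u n ω)) μ) :
    iIndepFun (fun i => choiceTwo u (i + 2)) μ := by
  have h := hindep.precomp (g := fun i : ℕ => (⟨i + 2, by omega⟩ : {n : ℕ // 2 ≤ n}))
    fun i j hij => by simpa using hij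
  exact h.comp (fun _ => Prod.snd) fun _ => measurable_snd

theorem memLp_gutPG [IsProbabilityMeasure μ] (hmeas : ∀ i, Measurable (choiceTwo u (i + 2)))
    (hsum : ∀ n, 2 ≤ n → ∀ ω, choiceOne u n ω + choiceTwo u n ω = 1) (n : ℕ) :
    MemLp (gutPG u n) 2 μ := by
  have h : MemLp (fun ω => ∑ i ∈ Finset.range (n - 2), gutmanCoeff n i * choiceTwo u (i + 2) ω)
      2 μ := memLp_finsetSum _ fun i _ => (memLp_choiceTwo (hmeas i)).const_mul _
  have h' := (memLp_const (μ := μ) (p := 2)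
    (gutmanConst n + ∑ i ∈ Finset.range (n - 2), gutmanCoeff n i)).add h
  exact h'.ae_eq (ae_of_all _ fun ω => (gutPG_eq hsum n ω).symm)

theorem variance_gutPG [IsProbabilityMeasure μ] (hmeas : ∀ i, Measurable (choiceTwo u (i + 2)))
    (hsum : ∀ n, 2 ≤ n → ∀ ω, choiceOne u n ω + choiceTwo u n ω = 1)
    (hlaw : ∀ n, 2 ≤ n →
      μ.real {ω | choiceTwo u n ω = 1} = 1 - p₁ ∧ μ.real {ω | choiceTwo u n ω = 0} = p₁)
    (hindep : iIndepFun (fun i => choiceTwo u (i + 2)) μ) {n : ℕ} (hn : 1 ≤ n) :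
    Var[gutPG u n; μ] =
      144 ^ 2 * (p₁ * (1 - p₁)) * (((n : ℝ) - 1) ^ 5 - (n - 1)) / 30 := by
  have hind : iIndepFun (fun i ω => gutmanCoeff n i * choiceTwo u (i + 2) ω) μ :=
    hindep.comp (fun i x => gutmanCoeff n i * x) (by fun_prop)
  have hmem : ∀ i, MemLp (fun ω => gutmanCoeff n i * choiceTwo u (i + 2) ω) 2 μ :=
    fun i => (memLp_choiceTwo (hmeas i)).const_mul _
  have hsum_eq : (fun ω => ∑ i ∈ Finset.range (n - 2), gutmanCoeff n i * choiceTwo u (i + 2) ω) =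
      ∑ i ∈ Finset.range (n - 2), fun ω => gutmanCoeff n i * choiceTwo u (i + 2) ω := by
    ext ω
    simp
  rw [funext (gutPG_eq hsum n), variance_const_add, hsum_eq,
    IndepFun.variance_sum (fun i _ => hmem i) fun i _ j _ hij => hind.indepFun hij]
  · simp only [variance_const_mul, variance_choiceTwo (hmeas _) (hlaw _ (Nat.le_add_left 2 _))]
    rw [← Finset.sum_mul, sum_gutmanCoeff_sq hn]
    ring
  · exact (Finset.measurable_fun_sum _ fun i _ => (hmeas i).const_mul _).aestronglyMeasurable

theorem integral_gutPG [IsProbabilityMeasure μ] (hmeas : ∀ i, Measurable (choiceTwo u (i + 2)))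
    (hsum : ∀ n, 2 ≤ n → ∀ ω, choiceOne u n ω + choiceTwo u n ω = 1)
    (hlaw : ∀ n, 2 ≤ n → μ.real {ω | choiceTwo u n ω = 1} = 1 - p₁) (n : ℕ) :
    ∫ ω, gutPG u n ω ∂μ = (gutmanConst n + ∑ i ∈ Finset.range (n - 2), gutmanCoeff n i) +
      ∑ i ∈ Finset.range (n - 2), gutmanCoeff n i * (1 - p₁) := by
  have hint : ∀ i ∈ Finset.range (n - 2),
      Integrable (fun ω => gutmanCoeff n i * choiceTwo u (i + 2) ω) μ :=
    fun i _ => ((memLp_choiceTwo (hmeas i)).integrable one_le_two).const_mul _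
  simp only [gutPG_eq hsum n]
  rw [integral_add (integrable_const _) (integrable_finsetSum _ hint), integral_finsetSum _ hint]
  simp only [integral_const_mul, integral_choiceTwo (hmeas _) (hlaw _ (Nat.le_add_left 2 _))]
  simp

theorem eventually_gutmanCoeff_small {q ε : ℝ} (hq : 0 < q) (hε : 0 < ε) :
    ∀ᶠ n : ℕ in atTop, ∀ i ∈ Finset.range (n - 2),
      |gutmanCoeff n i * √q / √(144 ^ 2 * q * (((n : ℝ) - 1) ^ 5 - (n - 1)) / 30)| ≤ ε := by
  -- With N = n - 1 ≥ 2, the squared weight is at most 30N⁴/(N⁵-N) ≤ 60/N, hence the threshold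
  -- 60/ε².
  filter_upwards [eventually_ge_atTop 3, eventually_ge_atTop (⌈60 / ε ^ 2⌉₊ + 1)]
    with n hn hnε i hi
  have hn' : (3 : ℝ) ≤ n := by exact_mod_cast hn
  have hnε' : 60 / ε ^ 2 ≤ (n : ℝ) - 1 := by
    have h1 : ((⌈60 / ε ^ 2⌉₊ + 1 : ℕ) : ℝ) ≤ n := by exact_mod_cast hnε
    push_cast at h1
    linarith [Nat.le_ceil (60 / ε ^ 2)]
  rw [div_le_iff₀ (by positivity)] at hnε'
  have hcoeff := gutmanCoeff_sq_le hi
  set N : ℝ := (n : ℝ) - 1 with hN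
  have hN2 : 2 ≤ N := by linarith
  have hN4 : 2 ≤ N ^ 4 := by nlinarith [sq_nonneg (N ^ 2 - 2), sq_nonneg (N - 2)]
  have hpow : N ^ 5 / 2 ≤ N ^ 5 - N := by nlinarith
  have hpos : 0 < N ^ 5 - N := lt_of_lt_of_le (by positivity) hpow
  apply abs_le_of_sq_le_sq _ hε.le
  rw [div_pow, mul_pow, Real.sq_sqrt hq.le, Real.sq_sqrt (by positivity),
    div_le_iff₀ (by positivity)]
  have h2 : 144 ^ 2 * N ^ 4 ≤ ε ^ 2 * (144 ^ 2 * (N ^ 5 - N) / 30) := by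
    have : 60 * N ^ 4 ≤ N * ε ^ 2 * N ^ 4 := by gcongr
    nlinarith [mul_le_mul_of_nonneg_left hpow (sq_nonneg ε)]
  calc gutmanCoeff n i ^ 2 * q ≤ 144 ^ 2 * N ^ 4 * q := by gcongr
    _ ≤ ε ^ 2 * (144 ^ 2 * (N ^ 5 - N) / 30) * q := by gcongr
    _ = _ := by ring

theorem tendsto_charFun_gutPG [IsProbabilityMeasure μ] (hp_pos : 0 < p₁) (hp_lt : p₁ < 1)
    (hmeas : ∀ i, Measurable (choiceTwo u (i + 2)))
    (hsum : ∀ n, 2 ≤ n → ∀ ω, choiceOne u n ω + choiceTwo u n ω = 1)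
    (hlaw : ∀ n, 2 ≤ n →
      μ.real {ω | choiceTwo u n ω = 1} = 1 - p₁ ∧ μ.real {ω | choiceTwo u n ω = 0} = p₁)
    (hindep : iIndepFun (fun i => choiceTwo u (i + 2)) μ) (t : ℝ) :
    Tendsto (fun n => charFun (μ.map fun ω =>
        (gutPG u n ω - ∫ ω', gutPG u n ω' ∂μ) / √(Var[gutPG u n; μ])) t) atTop
      (𝓝 (charFun (gaussianReal 0 1) t)) := by
  have hlaw' : ∀ i, _ := fun i => hlaw (i + 2) (Nat.le_add_left 2 i)
  have hq : 0 < p₁ * (1 - p₁) := mul_pos hp_pos (by linarith)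
  have hsq : √(p₁ * (1 - p₁)) ≠ 0 := (Real.sqrt_pos.2 hq).ne'
  let X : ℕ → Ω → ℝ := fun i ω => (choiceTwo u (i + 2) ω - (1 - p₁)) / √(p₁ * (1 - p₁))
  have hXmeas : ∀ i, Measurable (X i) := fun i => ((hmeas i).sub_const _).div_const _
  have hX_indep : iIndepFun X μ :=
    hindep.comp (fun _ x => (x - (1 - p₁)) / √(p₁ * (1 - p₁))) (by fun_prop)
  have hX_ident : ∀ i, IdentDistrib (X i) (X 0) μ μ := fun i =>
    (identDistrib_choiceTwo (hmeas i) (hmeas 0) ((hlaw' i).1.trans (hlaw' 0).1.symm)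
      ((hlaw' i).2.trans (hlaw' 0).2.symm)).comp
      (u := fun x => (x - (1 - p₁)) / √(p₁ * (1 - p₁))) (by fun_prop)
  have hint : Integrable (choiceTwo u (0 + 2)) μ :=
    (memLp_choiceTwo (hmeas 0)).integrable one_le_two
  have hX_mean : μ[X 0] = 0 := by
    simp only [X]
    rw [integral_div, integral_sub hint (integrable_const _),
      integral_choiceTwo (hmeas 0) (hlaw' 0).1]
    simp
  have hX_var : μ[X 0 ^ 2] = 1 := by
    refine (variance_of_integral_eq_zero (hXmeas 0).aemeasurable hX_mean).symm.trans ?_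
    simp only [X, div_eq_mul_inv]
    rw [variance_mul_const, variance_sub_const (hmeas 0).aestronglyMeasurable,
      variance_choiceTwo (hmeas 0) (hlaw' 0), inv_pow, Real.sq_sqrt hq.le,
      mul_inv_cancel₀ hq.ne']
  let w : ℕ → ℕ → ℝ := fun n i => gutmanCoeff n i * √(p₁ * (1 - p₁)) /
    √(144 ^ 2 * (p₁ * (1 - p₁)) * (((n : ℝ) - 1) ^ 5 - (n - 1)) / 30)
  have hclt := tendsto_charFun_weighted_sum hX_indep hX_ident hX_mean hX_var
    (fun n => Finset.range (n - 2)) w ?_ (fun ε hε => eventually_gutmanCoeff_small hq hε) t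
  · refine hclt.congr' ?_
    filter_upwards [eventually_ge_atTop 1] with n hn
    congr 2
    ext ω
    rw [integral_gutPG hmeas hsum (fun n h => (hlaw n h).1),
      variance_gutPG hmeas hsum hlaw hindep hn, gutPG_eq hsum, add_sub_add_left_eq_sub,
      ← Finset.sum_sub_distrib, Finset.sum_div]
    refine Finset.sum_congr rfl fun i _ => ?_
    simp only [w, X]
    field_simp
  · filter_upwards [eventually_ge_atTop 3] with n hn
    have hn' : (3 : ℝ) ≤ n := by exact_mod_cast hn
    have hpos : 0 < ((n : ℝ) - 1) ^ 5 - (n - 1) := by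
      have : (1 : ℝ) < ((n : ℝ) - 1) ^ 4 := one_lt_pow₀ (by linarith) (by norm_num)
      nlinarith
    simp only [w, div_pow, mul_pow]
    rw [← Finset.sum_div, ← Finset.sum_mul, sum_gutmanCoeff_sq (by omega), Real.sq_sqrt hq.le,
      Real.sq_sqrt (by positivity), div_eq_one_iff_eq (by positivity)]
    ring

end Chain

theorem theorem3p1 {Ω : Type*} [MeasurableSpace Ω] (μ : Measure Ω) [IsProbabilityMeasure μ]
    (p₁ : ℝ) (hp_pos : 0 < p₁) (hp_lt : p₁ < 1)
    (u : ℕ → Ω → Fin 5)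
    (hmeas : ∀ n, 2 ≤ n → Measurable (choiceOne u n) ∧ Measurable (choiceTwo u n))
    (hsum : ∀ n, 2 ≤ n → ∀ ω, choiceOne u n ω + choiceTwo u n ω = 1)
    (hlaw_one : ∀ n, 2 ≤ n →
      μ.real {ω | choiceOne u n ω = 1} = p₁ ∧ μ.real {ω | choiceOne u n ω = 0} = 1 - p₁)
    (hlaw_two : ∀ n, 2 ≤ n →
      μ.real {ω | choiceTwo u n ω = 1} = 1 - p₁ ∧ μ.real {ω | choiceTwo u n ω = 0} = p₁)
    (hindep : iIndepFun
      (fun (n : {n : ℕ // 2 ≤ n}) (ω : Ω) => (choiceOne u n ω, choiceTwo u n ω)) μ) :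
    (∀ n, 2 ≤ n →
      Var[stepU u n; μ] = sigmaSq p₁ ∧
      Var[stepV u n; μ] = sigmaTildeSq p₁ ∧
      cov[stepU u n, stepV u n; μ] = covR p₁) ∧
    (∀ n : ℕ, 1 ≤ n →
      MemLp (gutPG u n) 2 μ ∧
      Var[gutPG u n; μ] = (1 / 30 : ℝ) *
        (sigmaSq p₁ * (n : ℝ) ^ 5 - 5 * covR p₁ * (n : ℝ) ^ 4
          + 10 * sigmaTildeSq p₁ * (n : ℝ) ^ 3
          + (65 * covR p₁ - 30 * sigmaSq p₁ - 45 * sigmaTildeSq p₁) * (n : ℝ) ^ 2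
          + (59 * sigmaSq p₁ + 65 * sigmaTildeSq p₁ - 120 * covR p₁) * (n : ℝ)
          + (60 * covR p₁ - 30 * sigmaSq p₁ - 30 * sigmaTildeSq p₁))) ∧
    Tendsto
      (fun n : ℕ => ⨆ a : ℝ,
        |μ.real {ω | (gutPG u n ω - ∫ ω', gutPG u n ω' ∂μ) / √(Var[gutPG u n; μ]) ≤ a}
          - ∫ t in Set.Iic a, 1 / √(2 * Real.pi) * Real.exp (-t ^ 2 / 2)|)
      atTop (𝓝 0) := by
  have hmeas' : ∀ i, Measurable (choiceTwo u (i + 2)) :=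
    fun i => (hmeas (i + 2) (Nat.le_add_left 2 i)).2
  have hindep' := iIndepFun_choiceTwo hindep
  refine ⟨fun n hn => ?_, fun n hn => ⟨memLp_gutPG hmeas' hsum n, ?_⟩, ?_⟩
  · have hZ := (hmeas n hn).2
    have hint : Integrable (choiceTwo u n) μ := (memLp_choiceTwo hZ).integrable one_le_two
    have hvar := variance_choiceTwo hZ (hlaw_two n hn)
    have hU : stepU u n = fun ω => 288 + 144 * choiceTwo u n ω := by
      ext ω
      rw [stepU]
      linarith [hsum n hn ω]
    have hV : stepV u n = fun ω => 156 + 144 * choiceTwo u n ω := by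
      ext ω
      rw [stepV]
      linarith [hsum n hn ω]
    have hmul : Measurable fun ω => 144 * choiceTwo u n ω := hZ.const_mul _
    rw [hU, hV, variance_const_add hmul.aestronglyMeasurable,
      variance_const_add hmul.aestronglyMeasurable, covariance_const_add_left (hint.const_mul _),
      covariance_const_add_right (hint.const_mul _), covariance_self hmul.aemeasurable,
      variance_const_mul, hvar, sigmaSq, sigmaTildeSq, covR]
    refine ⟨?_, ?_, ?_⟩ <;> ring
  -- All three parameters equal 144²p₁(1-p₁), and the polynomial becomes (n-1)⁵-(n-1).
  · rw [variance_gutPG hmeas' hsum hlaw_two hindep' hn, sigmaSq, sigmaTildeSq, covR]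
    ring
  · exact tendsto_iSup_abs_sub_gaussian
      (fun n => ((memLp_gutPG hmeas' hsum n).aemeasurable.sub_const _).div_const _)
      (tendsto_charFun_gutPG hp_pos hp_lt hmeas' hsum hlaw_two hindep')
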